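/- For a polynomial $p\in\mathbb{R}[x]$ define $\mathscr{W}(p)\in\mathbb{R}[x]$, a polynomial of degree at most $\deg p$, by $$\sum_{j\ge 0}p(j)\,x^j=\frac{\mathscr{W}(p)(x)}{(1-x)^{\deg p+1}},$$ with the convention $\deg 0=0$ (so that $\mathscr{W}(0)=0$). For an integer $n$ and a polynomial $a$, write $\mathcal{I}_n(a)(x)=x^n a(1/x)$; this is a Laurent polynomial, and the equation $a=\mathcal{I}_n(a)$ forces $a=0$ or $\deg a\le n$. For a polynomial $h$ of degree at most $d$ there are unique polynomials $a,b$ with $$h(x)=a(x)+x\,b(x),\qquad a=\mathcal{I}_d(a),\qquad b=\mathcal{I}_{d-1}(b);$$ the pair $(a,b)$ is the symmetric decomposition of $h$ with respect to $d$. It is called nonnegative if $a$ and $b$ have only nonnegative coefficients. A polynomial $a$ with $a=\mathcal{I}_n(a)$ is called $\gamma$-positive (with center of symmetry $n/2$) if $a(x)=\sum_{i=0}^{\lfloor n/2\rfloor}\gamma_i\,x^i(1+x)^{n-2i}$ with $\gamma_i\ge 0$ for all $i$ (the sum is empty for $n=-1$). The symmetric decomposition $(a,b)$ of $h$ with respect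 to $d$ is called $\gamma$-positive if $a$ and $b$ are $\gamma$-positive, with centers of symmetry $d/2$ and $(d-1)/2$ respectively. The symmetric decomposition of $\mathscr{W}(p)$ is always taken with respect to $d=\deg p$. **Theorem.** Let $p,q\in\mathbb{R}[x]$. 1. If $\mathscr{W}(p)$ and $\mathscr{W}(q)$ have nonnegative symmetric decompositions, then so does $\mathscr{W}(pq)$. 2. If the symmetric decompositions of $\mathscr{W}(p)$ and $\mathscr{W}(q)$ are $\gamma$-positive, then so is the symmetric decomposition of $\mathscr{W}(pq)$. -/

import Mathlib

open Polynomial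
open scoped LaurentPolynomial

noncomputable section

/-- The generating function `∑_{j ≥ 0} p(j) x^j` of a real polynomial `p`. -/
def genFun (p : ℝ[X]) : PowerSeries ℝ :=
  PowerSeries.mk fun j => p.eval (j : ℝ)

/-- The numerator `𝒲(p)` of the rational generating function
`∑_{j ≥ 0} p(j) x^j = 𝒲(p)(x) / (1 - x)^{deg p + 1}`: the product
`(∑_{j ≥ 0} p(j) x^j) (1 - x)^{deg p + 1}`, cut off after degree `deg p`. The cut-off discards
nothing, see `genFun_mul_eq_numer`. By convention `deg 0 = 0`, so that `𝒲(0) = 0`. -/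
def numer (p : ℝ[X]) : ℝ[X] :=
  PowerSeries.trunc (p.natDegree + 1) (genFun p * (1 - PowerSeries.X) ^ (p.natDegree + 1))

theorem genFun_mul_one_sub_X_pow (m : ℕ) (p : ℝ[X]) (hp : p.degree < m) :
    ∃ h : ℝ[X], h.degree < m ∧ genFun p * (1 - PowerSeries.X) ^ m = (h : PowerSeries ℝ) := by
  induction m generalizing p with
  | zero =>
    have : p = 0 := by simpa using hp
    subst this
    refine ⟨0, by simp, ?_⟩
    ext n
    simp [genFun]
  | succ m ih =>
    have hd : (p.comp (X + C 1) - p).degree < m := by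
      rcases eq_or_ne p 0 with rfl | h0
      · simp
      · have h1 : (p.comp (X + C 1) - p).degree < p.degree := by
          have hdeg : (p.comp (X + C 1)).degree = p.degree := by
            rw [← taylor_apply]; exact degree_taylor p 1
          rw [← hdeg]
          refine degree_sub_lt_left hdeg ?_ ?_
          · intro h; rw [h] at hdeg; exact h0 (degree_eq_bot.mp (by simpa using hdeg.symm))
          · rw [← taylor_apply]; exact leadingCoeff_taylor 1 p
        have h2 : p.degree ≤ m := by
          rw [degree_eq_natDegree h0] at hp ⊢
          exact_mod_cast Nat.lt_succ_iff.mp (by exact_mod_cast hp)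
        exact lt_of_lt_of_le h1 h2
    obtain ⟨h, hh, he⟩ := ih _ hd
    have key : genFun p * (1 - PowerSeries.X)
        = PowerSeries.C (p.eval 0) + genFun (p.comp (X + C 1) - p) * PowerSeries.X := by
      rw [mul_sub, mul_one]
      ext n
      cases n with
      | zero => simp [genFun]
      | succ n => simp [genFun, PowerSeries.coeff_succ_mul_X]
    refine ⟨C (p.eval 0) * (1 - X) ^ m + h * X, ?_, ?_⟩
    · refine lt_of_le_of_lt (degree_add_le _ _) (max_lt ?_ ?_)
      · have h1 : (C (p.eval 0) * (1 - X : ℝ[X]) ^ m).natDegree ≤ m := by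
          refine (natDegree_C_mul_le _ _).trans (natDegree_pow_le.trans ?_)
          have : (1 - X : ℝ[X]).natDegree ≤ 1 :=
            (natDegree_sub_le _ _).trans (by simp)
          nlinarith
        refine lt_of_le_of_lt degree_le_natDegree ?_
        exact_mod_cast Nat.lt_succ_of_le h1
      · rw [degree_mul, degree_X]
        rcases eq_or_ne h 0 with rfl | h0
        · simp
        · rw [degree_eq_natDegree h0] at hh ⊢
          have : h.natDegree < m := by exact_mod_cast hh
          exact_mod_cast Nat.succ_lt_succ this
    · rw [pow_succ', ← mul_assoc, key, add_mul, mul_right_comm, he]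
      simp

/-- The defining property of the numerator. -/
theorem genFun_mul_eq_numer (p : ℝ[X]) :
    genFun p * (1 - PowerSeries.X) ^ (p.natDegree + 1) = (numer p : PowerSeries ℝ) := by
  obtain ⟨h, hh, he⟩ := genFun_mul_one_sub_X_pow (p.natDegree + 1) p
    (lt_of_le_of_lt degree_le_natDegree (by exact_mod_cast Nat.lt_succ_self _))
  rw [numer, he]
  congr 1
  ext n
  rw [PowerSeries.coeff_trunc]
  split_ifs with hn
  · simp
  · exact coeff_eq_zero_of_degree_lt
      (lt_of_lt_of_le hh (by exact_mod_cast Nat.le_of_not_lt hn))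

/-- The inversion `𝓘_n(a)(x) = x^n a(1/x)`, as a Laurent polynomial. The order `n` is an integer
because `𝓘_{d-1}` is also used for `d = 0`. -/
def inversion (n : ℤ) (a : ℝ[X]) : ℝ[T;T⁻¹] :=
  LaurentPolynomial.T n * LaurentPolynomial.invert (Polynomial.toLaurent a)

/-- `a` is symmetric with center of symmetry `n / 2`, that is, `𝓘_n(a) = a`. This forces
`deg a ≤ n` if `a ≠ 0`; in particular only `a = 0` is symmetric if `n < 0`. -/
def IsSymmetric (n : ℤ) (a : ℝ[X]) : Prop :=
  inversion n a = Polynomial.toLaurent a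

/-- `(a, b)` is the symmetric decomposition (the `𝓘_d`-decomposition) of `h`. -/
structure IsSymmDecomp (d : ℕ) (h a b : ℝ[X]) : Prop where
  eq_add : h = a + X * b
  symm_left : IsSymmetric d a
  symm_right : IsSymmetric ((d : ℤ) - 1) b

/-- All coefficients of `a` are nonnegative. -/
def NonnegCoeffs (a : ℝ[X]) : Prop :=
  ∀ i, 0 ≤ a.coeff i

/-- A polynomial `a` with center of symmetry `n / 2` is `γ`-positive:
`a = ∑_{i=0}^{⌊n/2⌋} γ_i x^i (1 + x)^{n - 2i}` with all `γ_i ≥ 0`.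
(The sum is empty if `n = -1`; in all its terms `n - 2i ≥ 0`.) -/
def IsGammaPositive (n : ℤ) (a : ℝ[X]) : Prop :=
  ∃ γ : ℕ → ℝ, (∀ i, 0 ≤ γ i) ∧
    a = ∑ i ∈ Finset.range (n / 2 + 1).toNat,
      C (γ i) * (X ^ i * (1 + X) ^ (n - 2 * (i : ℤ)).toNat)

/-- The symmetric decomposition of `h` (with respect to `d`) is nonnegative. -/
def HasNonnegSymmDecomp (d : ℕ) (h : ℝ[X]) : Prop :=
  ∃ a b : ℝ[X], IsSymmDecomp d h a b ∧ NonnegCoeffs a ∧ NonnegCoeffs b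

/-- The symmetric decomposition of `h` (with respect to `d`) is `γ`-positive. -/
def HasGammaPositiveSymmDecomp (d : ℕ) (h : ℝ[X]) : Prop :=
  ∃ a b : ℝ[X], IsSymmDecomp d h a b ∧ IsGammaPositive d a ∧ IsGammaPositive ((d : ℤ) - 1) b

end

noncomputable section

/-! Expand `p` in the basis `C(x, k)` and replace `C(x, k)` by `x^k`; call the result `F = umbral
p`. Since `∑ C(n, k) x^n = x^k / (1 - x)^(k+1)`, the numerator is `(1 - x)^d F(x / (1 - x))` with `d
= deg p` (`numer_eq_toNumer`). Multiplication of `p` and `q` becomes `F ⋄ G = ∑ D_k F · D_k G · (x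
(1 + x))^k`, where `D_k` is the `k`-th Hasse derivative (`umbral_mul`).

The substitution turns a symmetric decomposition `a + x b` into `F = A + x B`, with `A` and `B` in
cones `K d` and `K (d - 1)`. For nonnegativity, `K n` is spanned by `x^i (1 + x)^j + x^j (1 + x)^i`
with `i + j = n`; for `γ`-positivity, by `(x (1 + x))^i (1 + 2 x)^j` with `2 i + j = n`. Both
families are closed under products and derivatives and contain `x (1 + x)` and `1 + 2 x`
(`isDerivCone_nonnegGen`, `isDerivCone_gammaGen`).

These closure properties alone make the form `A + x B` stable under `⋄` (`IsDerivCone.diamond_mem`).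
The only terms with no evident place contain `x^2`; writing `x^2 = x (1 + 2 x) - x (1 + x)` leaves
negative terms that telescope away. Thus both assertions follow from one argument,
`HasSpanDecomp.numer_mul`. -/

/-! ### The binomial basis and evaluation at natural numbers -/

/-- Multiplication by the variable, transported along `C(x, k) ↦ x^k`. -/
def umbralMulX : Module.End ℝ ℝ[X] :=
  LinearMap.mulLeft ℝ X + LinearMap.mulLeft ℝ (X * (1 + X)) ∘ₗ derivative

theorem umbralMulX_apply (f : ℝ[X]) :
    umbralMulX f = X * f + X * (1 + X) * derivative f := rfl

/-- The linear map with `C(x, k) ↦ x^k`. -/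
def umbral (p : ℝ[X]) : ℝ[X] := aeval umbralMulX p 1

theorem natDegree_umbralMulX_le (f : ℝ[X]) : (umbralMulX f).natDegree ≤ f.natDegree + 1 := by
  rw [umbralMulX_apply]
  rcases Nat.eq_zero_or_pos f.natDegree with h | h
  · rw [eq_C_of_natDegree_eq_zero h]
    simpa using (natDegree_mul_le (p := (X : ℝ[X])) (q := C (f.coeff 0)))
  · have h1 := natDegree_derivative_le f
    have h2 : (X * (1 + X) : ℝ[X]).natDegree ≤ 2 := by compute_degree
    refine natDegree_add_le_of_degree_le ?_ ?_
    · refine natDegree_mul_le.trans ?_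
      rw [natDegree_X]; omega
    · exact natDegree_mul_le.trans (by omega)

theorem natDegree_umbral_le (p : ℝ[X]) : (umbral p).natDegree ≤ p.natDegree := by
  have key : ∀ k, ((umbralMulX ^ k) (1 : ℝ[X])).natDegree ≤ k := by
    intro k
    induction k with
    | zero => simp
    | succ k ih =>
      rw [pow_succ', Module.End.mul_apply]
      exact (natDegree_umbralMulX_le _).trans (by omega)
  rw [umbral, aeval_eq_sum_range, LinearMap.sum_apply]
  refine natDegree_sum_le_of_forall_le _ _ fun k hk => ?_
  rw [LinearMap.smul_apply]
  exact (natDegree_smul_le _ _).trans ((key k).trans (by simpa [Nat.lt_succ_iff] using hk))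

/-- The linear functional `x^k ↦ C(n, k)`. -/
def binomEval (n : ℕ) : ℝ[X] →ₗ[ℝ] ℝ :=
  ∑ k ∈ Finset.range (n + 1), (n.choose k : ℝ) • lcoeff ℝ k

theorem binomEval_X_pow (n k : ℕ) : binomEval n (X ^ k) = n.choose k := by
  simp only [binomEval, LinearMap.sum_apply, LinearMap.smul_apply, lcoeff_apply, coeff_X_pow,
    smul_eq_mul, mul_ite, mul_one, mul_zero, Finset.sum_ite_eq', Finset.mem_range]
  split_ifs with h
  · rfl
  · rw [Nat.choose_eq_zero_of_lt (by omega), Nat.cast_zero]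

/-- On monomials this is the absorption identity `n C(n, k) = k C(n, k) + (k + 1) C(n, k + 1)`. -/
theorem binomEval_umbralMulX (n : ℕ) (f : ℝ[X]) :
    binomEval n (umbralMulX f) = n * binomEval n f := by
  suffices binomEval n ∘ₗ umbralMulX = (n : ℝ) • binomEval n from LinearMap.congr_fun this f
  refine lhom_ext' fun k => LinearMap.ext_ring ?_
  have hm : (monomial k (1 : ℝ)) = X ^ k := by rw [monomial_one_right_eq_X_pow]
  have e : umbralMulX (X ^ k) = (k : ℝ) • X ^ k + (k + 1 : ℝ) • X ^ (k + 1) := by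
    rw [umbralMulX_apply, derivative_X_pow]
    cases k with
    | zero => simp
    | succ k => simp [smul_eq_C_mul]; ring
  simp only [LinearMap.comp_apply, LinearMap.smul_apply, hm, e, map_add, map_smul,
    binomEval_X_pow, smul_eq_mul]
  rcases le_or_gt k n with h | h
  · have := Nat.choose_succ_right_eq n k
    have : (n.choose (k + 1) * (k + 1) : ℝ) = n.choose k * (n - k) := by
      rw [← Nat.cast_sub h]; exact_mod_cast this
    linear_combination this
  · rw [Nat.choose_eq_zero_of_lt h, Nat.choose_eq_zero_of_lt (by omega : n < k + 1)]; simp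

theorem binomEval_umbral (n : ℕ) (p : ℝ[X]) : binomEval n (umbral p) = p.eval (n : ℝ) := by
  have key : ∀ k, binomEval n ((umbralMulX ^ k) 1) = (n : ℝ) ^ k := by
    intro k
    induction k with
    | zero => simpa using binomEval_X_pow n 0
    | succ k ih => rw [pow_succ', Module.End.mul_apply, binomEval_umbralMulX, ih, pow_succ']
  rw [umbral, aeval_eq_sum_range, LinearMap.sum_apply, map_sum, eval_eq_sum_range]
  simp [key]

/-! ### The transported product -/

/-- The product on `ℝ[X]` to which multiplication is transported along `C(x, k) ↦ x^k`, provided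
that `M` is large. -/
def diamond (M : ℕ) (f g : ℝ[X]) : ℝ[X] :=
  ∑ k ∈ Finset.range M, hasseDeriv k f * hasseDeriv k g * (X * (1 + X)) ^ k

theorem hasseDeriv_succ_X_mul (k : ℕ) (f : ℝ[X]) :
    hasseDeriv (k + 1) (X * f) = X * hasseDeriv (k + 1) f + hasseDeriv k f := by
  ext n
  cases n with
  | zero => simp [hasseDeriv_coeff, coeff_X_mul]
  | succ n =>
    simp only [hasseDeriv_coeff, coeff_add, coeff_X_mul]
    rw [show n + 1 + (k + 1) = (n + (k + 1)) + 1 by ring, coeff_X_mul,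
      show n + 1 + k = n + (k + 1) by ring, Nat.choose_succ_succ (n + (k + 1)) k]
    push_cast; ring

theorem hasseDeriv_derivative (k : ℕ) (f : ℝ[X]) :
    hasseDeriv k (derivative f) = (k + 1 : ℝ[X]) * hasseDeriv (k + 1) f := by
  have := LinearMap.congr_fun (hasseDeriv_comp (R := ℝ) k 1) f
  rw [LinearMap.comp_apply, hasseDeriv_one', LinearMap.smul_apply] at this
  simpa using this

theorem derivative_hasseDeriv (k : ℕ) (f : ℝ[X]) :
    derivative (hasseDeriv k f) = (k + 1 : ℝ[X]) * hasseDeriv (k + 1) f := by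
  have := LinearMap.congr_fun (hasseDeriv_comp (R := ℝ) 1 k) f
  rw [LinearMap.comp_apply, hasseDeriv_one', LinearMap.smul_apply] at this
  simpa [add_comm] using this

theorem hasseDeriv_succ_umbralMulX (k : ℕ) (f : ℝ[X]) :
    hasseDeriv (k + 1) (umbralMulX f) =
      X * hasseDeriv (k + 1) f + (k + 1 : ℝ[X]) * hasseDeriv k f
        + (k + 2 : ℝ[X]) * (X * (1 + X)) * hasseDeriv (k + 2) f
        + (k + 1 : ℝ[X]) * (1 + 2 * X) * hasseDeriv (k + 1) f := by
  rw [umbralMulX_apply, show X * f + X * (1 + X) * derivative f =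
    X * f + X * derivative f + X * (X * derivative f) by ring]
  cases k with
  | zero =>
    simp only [map_add, hasseDeriv_succ_X_mul, hasseDeriv_zero', hasseDeriv_derivative]
    simp; ring
  | succ k =>
    simp only [map_add, hasseDeriv_succ_X_mul, hasseDeriv_derivative]
    push_cast; ring

/-- The summands do not commute with `umbralMulX` one by one, but their defects telescope. With
`diamond_one`, this determines the product with any polynomial in `umbralMulX` applied to `1`. -/
theorem diamond_umbralMulX {M : ℕ} (f : ℝ[X]) {g : ℝ[X]} (hg : g.natDegree < M) :
    diamond M (umbralMulX f) g = umbralMulX (diamond M f g) := by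
  -- The explicit defect of the partial sum makes the induction work; it vanishes at `L = M > deg
  -- g`. At `L = 0` the truncated `L - 1` is harmless because of the factor `L`.
  have hM : ∀ L, (∑ k ∈ Finset.range L,
      hasseDeriv k (umbralMulX f) * hasseDeriv k g * (X * (1 + X)) ^ k) =
      umbralMulX (∑ k ∈ Finset.range L, hasseDeriv k f * hasseDeriv k g * (X * (1 + X)) ^ k)
        - (L : ℝ[X]) * hasseDeriv (L - 1) f * hasseDeriv L g * (X * (1 + X)) ^ L := by
    intro L
    induction L with
    | zero => simp
    | succ L ih =>
      rw [Finset.sum_range_succ, ih, Finset.sum_range_succ, map_add]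
      cases L with
      | zero =>
        simp only [umbralMulX_apply, hasseDeriv_zero', derivative_mul, hasseDeriv_one',
          pow_zero, mul_one, zero_add, Nat.cast_zero, Nat.cast_one, pow_one, Finset.range_zero,
          Finset.sum_empty, Nat.sub_self, derivative_zero]
        ring
      | succ L =>
        rw [hasseDeriv_succ_umbralMulX]
        simp only [umbralMulX_apply, derivative_mul, derivative_pow, derivative_hasseDeriv,
          Nat.add_sub_cancel]
        simp only [derivative_X, derivative_one, map_natCast, Nat.cast_add,
          Nat.cast_one, map_add, map_one]
        ring
  rw [diamond, hM, hasseDeriv_eq_zero_of_lt_natDegree g M hg]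
  simp [diamond]

theorem diamond_one {M : ℕ} (hM : 0 < M) (g : ℝ[X]) : diamond M 1 g = g := by
  rw [diamond, Finset.sum_eq_single_of_mem 0 (by simpa using hM)]
  · simp
  · intro k _ hk
    rw [hasseDeriv_apply_one k (by omega)]; simp

theorem umbral_mul {M : ℕ} (p q : ℝ[X]) (hM : q.natDegree < M) :
    umbral (p * q) = diamond M (umbral p) (umbral q) := by
  have hq := (natDegree_umbral_le q).trans_lt hM
  have key : ∀ k, diamond M ((umbralMulX ^ k) 1) (umbral q) = (umbralMulX ^ k) (umbral q) := by
    intro k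
    induction k with
    | zero => simpa using diamond_one (by omega) _
    | succ k ih =>
      rw [pow_succ', Module.End.mul_apply, Module.End.mul_apply, diamond_umbralMulX _ hq, ih]
  have e1 : umbral (p * q) =
      ∑ k ∈ Finset.range (p.natDegree + 1), p.coeff k • (umbralMulX ^ k) (umbral q) := by
    rw [umbral, map_mul, Module.End.mul_apply, ← umbral, aeval_eq_sum_range, LinearMap.sum_apply]
    rfl
  have e2 : umbral p =
      ∑ k ∈ Finset.range (p.natDegree + 1), p.coeff k • (umbralMulX ^ k) 1 := by
    rw [umbral, aeval_eq_sum_range, LinearMap.sum_apply]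
    rfl
  rw [e1, e2]
  simp only [← key, diamond, map_sum, map_smul, Finset.sum_mul, Finset.smul_sum, smul_mul_assoc]
  exact Finset.sum_comm

/-! ### Passage to the numerator -/

/-- The linear map `F ↦ (1 - x)^n F(x / (1 - x))` on polynomials of degree at most `n`. -/
def toNumer (n : ℕ) : ℝ[X] →ₗ[ℝ] ℝ[X] where
  toFun F := reflect n (taylor (-1) (reflect n F))
  map_add' f g := by simp [reflect_add]
  map_smul' c f := by simp [smul_eq_C_mul, reflect_C_mul]

theorem toNumer_apply (n : ℕ) (F : ℝ[X]) :
    toNumer n F = reflect n (taylor (-1) (reflect n F)) := rfl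

theorem toNumer_injective (n : ℕ) : Function.Injective (toNumer n) := by
  intro f g h
  simp only [toNumer_apply] at h
  have h2 := congrArg (reflect n) h
  rw [reflect_reflect, reflect_reflect] at h2
  have h3 := congrArg (reflect n) (taylor_injective _ h2)
  rwa [reflect_reflect, reflect_reflect] at h3

/-- The factor `(1 - x)^(m + n)` splits; the degree bounds are needed because `reflect` is
multiplicative only below its reflection degrees. -/
theorem toNumer_mul {m n : ℕ} {f g : ℝ[X]} (hf : f.natDegree ≤ m) (hg : g.natDegree ≤ n) :
    toNumer (m + n) (f * g) = toNumer m f * toNumer n g := by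
  have h : ∀ {l : ℕ} {f : ℝ[X]}, f.natDegree ≤ l → (taylor (-1) (reflect l f)).natDegree ≤ l := by
    intro l f hl
    rw [natDegree_taylor]
    exact natDegree_reflect_le.trans (by omega)
  rw [toNumer_apply, reflect_mul _ _ hf hg, taylor_mul, reflect_mul _ _ (h hf) (h hg)]
  rfl

theorem toNumer_pow {m : ℕ} {f : ℝ[X]} (hf : f.natDegree ≤ m) (k : ℕ) :
    toNumer (k * m) (f ^ k) = toNumer m f ^ k := by
  induction k with
  | zero => simp [toNumer_apply]
  | succ k ih =>
    rw [Nat.succ_mul, pow_succ, toNumer_mul (natDegree_pow_le_of_le k hf) hf, ih, pow_succ]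

theorem reflect_one_one : reflect 1 (1 : ℝ[X]) = X := by simp

theorem toNumer_one_X : toNumer 1 X = X := by
  simp [toNumer_apply]

theorem toNumer_one_one : toNumer 1 1 = 1 - X := by
  rw [toNumer_apply, reflect_one_one, taylor_X, reflect_add, reflect_C, reflect_one_X]
  simp [sub_eq_add_neg]

theorem toNumer_one_one_add_X : toNumer 1 (1 + X) = 1 := by
  rw [map_add, toNumer_one_one, toNumer_one_X]; ring

theorem toNumer_X_pow {m k : ℕ} (h : k ≤ m) :
    toNumer m (X ^ k) = X ^ k * (1 - X) ^ (m - k) := by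
  obtain ⟨l, rfl⟩ := Nat.exists_eq_add_of_le h
  have h1 := toNumer_pow (m := 1) (f := X) natDegree_X_le k
  have h2 := toNumer_pow (m := 1) (f := 1) (by simp) l
  rw [mul_one, toNumer_one_X] at h1
  rw [mul_one, one_pow, toNumer_one_one] at h2
  have := toNumer_mul (m := k) (n := l) (f := X ^ k) (g := 1) (by simp) (by simp)
  rw [mul_one, h1, h2] at this
  rw [this, Nat.add_sub_cancel_left]

theorem mk_choose_mul_one_sub_X_pow {m k : ℕ} (h : k ≤ m) :
    (PowerSeries.mk fun n => (n.choose k : ℝ)) * (1 - PowerSeries.X) ^ (m + 1) =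
      PowerSeries.X ^ k * (1 - PowerSeries.X) ^ (m - k) := by
  have e : (PowerSeries.mk fun n => (n.choose k : ℝ)) =
      PowerSeries.X ^ k * PowerSeries.mk fun n => ((k + n).choose k : ℝ) := by
    ext n
    rw [PowerSeries.coeff_X_pow_mul']
    split_ifs with hn
    · simp [Nat.add_sub_cancel' hn]
    · simp [Nat.choose_eq_zero_of_lt (not_le.mp hn)]
  rw [e, show m + 1 = (k + 1) + (m - k) by omega, pow_add, mul_assoc, ← mul_assoc (PowerSeries.mk _),
    PowerSeries.mk_add_choose_mul_one_sub_pow_eq_one, one_mul]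

/-- Both sides are linear in the binomial expansion, so the generating function of a single `C(n,
k)` suffices. -/
theorem numer_eq_toNumer (p : ℝ[X]) : numer p = toNumer p.natDegree (umbral p) := by
  have key : ∀ (m : ℕ) (F : ℝ[X]), F.natDegree ≤ m →
      (PowerSeries.mk fun n => binomEval n F) * (1 - PowerSeries.X) ^ (m + 1) =
        (toNumer m F : PowerSeries ℝ) := by
    intro m F hF
    have e : (PowerSeries.mk fun n => binomEval n F) = ∑ k ∈ Finset.range (F.natDegree + 1),
        PowerSeries.C (F.coeff k) * PowerSeries.mk fun n => (n.choose k : ℝ) := by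
      ext n
      conv_lhs => rw [F.as_sum_range_C_mul_X_pow]
      simp [← smul_eq_C_mul, binomEval_X_pow]
    have e2 : toNumer m F = ∑ k ∈ Finset.range (F.natDegree + 1),
        C (F.coeff k) * (X ^ k * (1 - X) ^ (m - k)) := by
      conv_lhs => rw [F.as_sum_range_C_mul_X_pow]
      rw [map_sum]
      refine Finset.sum_congr rfl fun k hk => ?_
      rw [← smul_eq_C_mul, map_smul, toNumer_X_pow, smul_eq_C_mul]
      have := Finset.mem_range.mp hk
      omega
    rw [e, e2, Finset.sum_mul, ← coeToPowerSeries.ringHom_apply, map_sum]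
    refine Finset.sum_congr rfl fun k hk => ?_
    rw [mul_assoc, mk_choose_mul_one_sub_X_pow (by have := Finset.mem_range.mp hk; omega)]
    simp
  have h := key _ _ (natDegree_umbral_le p)
  simp only [binomEval_umbral] at h
  exact Polynomial.coe_injective ℝ ((genFun_mul_eq_numer p).symm.trans h)

/-! ### Cones stable under products and derivatives -/

/-- A graded family of convex cones of polynomials which is stable under multiplication and
differentiation and contains `x (1 + x)` and `1 + 2 x` in degrees `2` and `1`. -/
structure IsDerivCone (K : ℤ → Submodule NNReal ℝ[X]) : Prop where
  one_mem : 1 ∈ K 0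
  mul_mem : ∀ {m n : ℤ} {f g : ℝ[X]}, f ∈ K m → g ∈ K n → f * g ∈ K (m + n)
  derivative_mem : ∀ {n : ℤ} {f : ℝ[X]}, f ∈ K n → derivative f ∈ K (n - 1)
  X_mul_one_add_X_mem : X * (1 + X) ∈ K 2
  one_add_two_mul_X_mem : 1 + 2 * X ∈ K 1

namespace IsDerivCone

variable {K : ℤ → Submodule NNReal ℝ[X]}

theorem mul_mem' {l m n : ℤ} {f g : ℝ[X]} (hK : IsDerivCone K) (hf : f ∈ K m) (hg : g ∈ K n)
    (h : m + n = l) : f * g ∈ K l :=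
  h ▸ hK.mul_mem hf hg

theorem X_mul_one_add_X_pow_mem (hK : IsDerivCone K) (k : ℕ) : (X * (1 + X)) ^ k ∈ K (2 * k) := by
  induction k with
  | zero => simpa using hK.one_mem
  | succ k ih =>
    rw [pow_succ]
    exact hK.mul_mem' ih hK.X_mul_one_add_X_mem (by push_cast; ring)

/-- Inductively, `D_(k+1) = (D_k)' / (k + 1)`, and a cone admits division by positive numbers. -/
theorem hasseDeriv_mem (hK : IsDerivCone K) {n : ℤ} {f : ℝ[X]} (hf : f ∈ K n) (k : ℕ) :
    hasseDeriv k f ∈ K (n - k) := by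
  induction k with
  | zero => simpa using hf
  | succ k ih =>
    have h1 := (K _).smul_mem ((k + 1 : NNReal)⁻¹) (hK.derivative_mem ih)
    rw [derivative_hasseDeriv, NNReal.smul_def, smul_eq_C_mul, ← mul_assoc] at h1
    have h2 : C (((k + 1 : NNReal)⁻¹ : NNReal) : ℝ) * (k + 1 : ℝ[X]) = 1 := by
      have : (k + 1 : ℝ[X]) = C (k + 1 : ℝ) := by simp
      rw [this, ← C_mul]
      push_cast
      rw [inv_mul_cancel₀ (by positivity), C_1]
    rw [h2, one_mul] at h1
    convert h1 using 2
    push_cast; ring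

/-- By Leibniz, `D_(k+1)(A + x B) = D_(k+1) A + D_k B + x D_(k+1) B`. In each product, the terms
free of `x` have degree `m + n` and those with one `x` belong to `B''`. The terms with `x^2` are
split by `x^2 = x (1 + 2 x) - x (1 + x)`; the negative halves cancel the products `D_k B · D_k B'`
with `k ≥ 1`, and `k = 0` combines with `x^2 B B'` into `x (1 + 2 x) B B'`. -/
theorem diamond_mem (hK : IsDerivCone K) {m n : ℤ} {A B A' B' : ℝ[X]}
    (hA : A ∈ K m) (hB : B ∈ K (m - 1)) (hA' : A' ∈ K n) (hB' : B' ∈ K (n - 1)) {M : ℕ}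
    (hM : B'.natDegree < M) :
    ∃ A'' ∈ K (m + n), ∃ B'' ∈ K (m + n - 1),
      diamond (M + 1) (A + X * B) (A' + X * B') = A'' + X * B'' := by
  have h1 : diamond (M + 1) (A + X * B) (A' + X * B') =
      (A + X * B) * (A' + X * B') + ∑ k ∈ Finset.range M,
        (hasseDeriv (k + 1) A + hasseDeriv k B + X * hasseDeriv (k + 1) B) *
          (hasseDeriv (k + 1) A' + hasseDeriv k B' + X * hasseDeriv (k + 1) B') *
            (X * (1 + X)) ^ (k + 1) := by
    rw [diamond, Finset.sum_range_succ']
    simp only [map_add, hasseDeriv_succ_X_mul, hasseDeriv_zero', pow_zero, mul_one]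
    rw [add_comm]
    congr 1
    refine Finset.sum_congr rfl fun k _ => ?_
    ring
  -- An index shift for the telescoping; the extra term at `k = M` vanishes since `M > deg B'`.
  have h2 : ∑ k ∈ Finset.range M, hasseDeriv k B * hasseDeriv k B' * (X * (1 + X)) ^ (k + 1) =
      X * (1 + X) * (B * B') + ∑ k ∈ Finset.range M,
        hasseDeriv (k + 1) B * hasseDeriv (k + 1) B' * (X * (1 + X)) ^ (k + 2) := by
    have := Finset.sum_range_succ' (fun k =>
      hasseDeriv k B * hasseDeriv k B' * (X * (1 + X)) ^ (k + 1)) M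
    rw [Finset.sum_range_succ, hasseDeriv_eq_zero_of_lt_natDegree B' M hM] at this
    simp only [hasseDeriv_zero', mul_zero, zero_mul, add_zero, zero_add, pow_one] at this
    rw [this]
    ring
  have e : ∀ {f : ℝ[X]} {l : ℤ} (k : ℕ), f ∈ K l → hasseDeriv (k + 1) f ∈ K (l - 1 - k) := by
    intro f l k hf
    convert hK.hasseDeriv_mem hf (k + 1) using 2
    push_cast; ring
  refine ⟨A * A' + ∑ k ∈ Finset.range M,
      (hasseDeriv (k + 1) A * hasseDeriv (k + 1) A' + hasseDeriv (k + 1) A * hasseDeriv k B' +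
        hasseDeriv k B * hasseDeriv (k + 1) A') * (X * (1 + X)) ^ (k + 1), ?_,
    A * B' + B * A' + (1 + 2 * X) * (B * B') + ∑ k ∈ Finset.range M,
      ((hasseDeriv (k + 1) A + hasseDeriv k B) * hasseDeriv (k + 1) B' +
        hasseDeriv (k + 1) B * (hasseDeriv (k + 1) A' + hasseDeriv k B') +
        (1 + 2 * X) * (hasseDeriv (k + 1) B * hasseDeriv (k + 1) B')) *
          (X * (1 + X)) ^ (k + 1), ?_, ?_⟩
  · refine add_mem (hK.mul_mem hA hA') (sum_mem fun k _ => ?_)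
    refine hK.mul_mem' (m := m + n - 2 - 2 * k) ?_ (hK.X_mul_one_add_X_pow_mem (k + 1))
      (by push_cast; ring)
    refine add_mem (add_mem ?_ ?_) ?_
    · exact hK.mul_mem' (e k hA) (e k hA') (by ring)
    · exact hK.mul_mem' (e k hA) (hK.hasseDeriv_mem hB' k) (by ring)
    · exact hK.mul_mem' (hK.hasseDeriv_mem hB k) (e k hA') (by ring)
  · refine add_mem (add_mem (add_mem ?_ ?_) ?_) (sum_mem fun k _ => ?_)
    · exact hK.mul_mem' hA hB' (by ring)
    · exact hK.mul_mem' hB hA' (by ring)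
    · exact hK.mul_mem' hK.one_add_two_mul_X_mem (hK.mul_mem hB hB') (by ring)
    refine hK.mul_mem' (m := m + n - 3 - 2 * k) ?_ (hK.X_mul_one_add_X_pow_mem (k + 1))
      (by push_cast; ring)
    refine add_mem (add_mem ?_ ?_) ?_
    · exact hK.mul_mem' (add_mem (e k hA) (hK.hasseDeriv_mem hB k)) (e k hB') (by ring)
    · exact hK.mul_mem' (e k hB) (add_mem (e k hA') (hK.hasseDeriv_mem hB' k)) (by ring)
    · exact hK.mul_mem' hK.one_add_two_mul_X_mem (hK.mul_mem (e k hB) (e k hB')) (by ring)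
  · rw [h1]
    have h3 : ∑ k ∈ Finset.range M,
        (hasseDeriv (k + 1) A + hasseDeriv k B + X * hasseDeriv (k + 1) B) *
          (hasseDeriv (k + 1) A' + hasseDeriv k B' + X * hasseDeriv (k + 1) B') *
            (X * (1 + X)) ^ (k + 1) =
      ∑ k ∈ Finset.range M,
        (hasseDeriv (k + 1) A * hasseDeriv (k + 1) A' + hasseDeriv (k + 1) A * hasseDeriv k B' +
          hasseDeriv k B * hasseDeriv (k + 1) A') * (X * (1 + X)) ^ (k + 1) +
      X * ∑ k ∈ Finset.range M,
        ((hasseDeriv (k + 1) A + hasseDeriv k B) * hasseDeriv (k + 1) B' +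
          hasseDeriv (k + 1) B * (hasseDeriv (k + 1) A' + hasseDeriv k B') +
          (1 + 2 * X) * (hasseDeriv (k + 1) B * hasseDeriv (k + 1) B')) *
            (X * (1 + X)) ^ (k + 1) +
      (∑ k ∈ Finset.range M, hasseDeriv k B * hasseDeriv k B' * (X * (1 + X)) ^ (k + 1) -
        ∑ k ∈ Finset.range M,
          hasseDeriv (k + 1) B * hasseDeriv (k + 1) B' * (X * (1 + X)) ^ (k + 2)) := by
      rw [Finset.mul_sum, ← Finset.sum_sub_distrib, ← Finset.sum_add_distrib,
        ← Finset.sum_add_distrib]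
      refine Finset.sum_congr rfl fun k _ => ?_
      ring
    rw [h3, h2]
    ring

end IsDerivCone

theorem isDerivCone_span {S : ℤ → Set ℝ[X]}
    (one_mem : 1 ∈ Submodule.span NNReal (S 0))
    (mul_mem : ∀ {m n : ℤ} {f g : ℝ[X]}, f ∈ S m → g ∈ S n →
      f * g ∈ Submodule.span NNReal (S (m + n)))
    (derivative_mem : ∀ {n : ℤ} {f : ℝ[X]}, f ∈ S n →
      derivative f ∈ Submodule.span NNReal (S (n - 1)))
    (X_mul_one_add_X_mem : X * (1 + X) ∈ Submodule.span NNReal (S 2))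
    (one_add_two_mul_X_mem : 1 + 2 * X ∈ Submodule.span NNReal (S 1)) :
    IsDerivCone fun n => Submodule.span NNReal (S n) where
  one_mem := one_mem
  mul_mem {m n f g} hf hg := by
    induction hf, hg using Submodule.span_induction₂ with
    | mem_mem f g hf hg => exact mul_mem hf hg
    | zero_left g _ => simp
    | zero_right f _ => simp
    | add_left f f' g _ _ _ h h' => rw [add_mul]; exact add_mem h h'
    | add_right f g g' _ _ _ h h' => rw [mul_add]; exact add_mem h h'
    | smul_left c f g _ _ h => rw [smul_mul_assoc]; exact Submodule.smul_mem _ c h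
    | smul_right c f g _ _ h => rw [mul_smul_comm]; exact Submodule.smul_mem _ c h
  derivative_mem {n f} hf := by
    induction hf using Submodule.span_induction with
    | mem f hf => exact derivative_mem hf
    | zero => simp
    | add f g _ _ hf hg => rw [derivative_add]; exact add_mem hf hg
    | smul c f _ hf => rw [derivative_smul]; exact Submodule.smul_mem _ c hf
  X_mul_one_add_X_mem := X_mul_one_add_X_mem
  one_add_two_mul_X_mem := one_add_two_mul_X_mem

/-! ### The two cones -/

/-- The generators `x^i (1 + x)^j + x^j (1 + x)^i` with `i + j = n`. -/
def nonnegGen (n : ℤ) : Set ℝ[X] :=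
  {f | ∃ i j : ℕ, (i + j : ℤ) = n ∧ f = X ^ i * (1 + X) ^ j + X ^ j * (1 + X) ^ i}

/-- The generators `(x (1 + x))^i (1 + 2 x)^j` with `2 i + j = n`. -/
def gammaGen (n : ℤ) : Set ℝ[X] :=
  {f | ∃ i j : ℕ, (2 * i + j : ℤ) = n ∧ f = (X * (1 + X)) ^ i * (1 + 2 * X) ^ j}

theorem mem_of_two_mul_mem {V : Submodule NNReal ℝ[X]} {f : ℝ[X]} (h : 2 * f ∈ V) : f ∈ V := by
  have := V.smul_mem (2⁻¹ : NNReal) h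
  rw [NNReal.smul_def, smul_eq_C_mul, ← mul_assoc, ← C_ofNat 2, ← C_mul] at this
  simpa using this

theorem natCast_mul_mem {V : Submodule NNReal ℝ[X]} {f : ℝ[X]} (k : ℕ) (h : f ∈ V) :
    (k : ℝ[X]) * f ∈ V := by
  rw [← nsmul_eq_mul]; exact nsmul_mem h k

theorem isDerivCone_nonnegGen : IsDerivCone fun n => Submodule.span NNReal (nonnegGen n) := by
  refine isDerivCone_span ?_ ?_ ?_ ?_ ?_
  -- The generator with `i = j = 0` is `2`, hence the halving; likewise `i = j = 1` gives `2 x (1 +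
  -- x)`.
  · refine mem_of_two_mul_mem (Submodule.subset_span ⟨0, 0, by simp, ?_⟩)
    norm_num
  · rintro m n _ _ ⟨i, j, rfl, rfl⟩ ⟨k, l, rfl, rfl⟩
    have : (X ^ i * (1 + X) ^ j + X ^ j * (1 + X) ^ i : ℝ[X]) *
        (X ^ k * (1 + X) ^ l + X ^ l * (1 + X) ^ k) =
        (X ^ (i + k) * (1 + X) ^ (j + l) + X ^ (j + l) * (1 + X) ^ (i + k)) +
        (X ^ (i + l) * (1 + X) ^ (j + k) + X ^ (j + k) * (1 + X) ^ (i + l)) := by ring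
    rw [this]
    exact add_mem (Submodule.subset_span ⟨_, _, by push_cast; ring, rfl⟩)
      (Submodule.subset_span ⟨_, _, by push_cast; ring, rfl⟩)
  · rintro n _ ⟨i, j, rfl, rfl⟩
    have : derivative (X ^ i * (1 + X) ^ j + X ^ j * (1 + X) ^ i : ℝ[X]) =
        (i : ℝ[X]) * (X ^ (i - 1) * (1 + X) ^ j + X ^ j * (1 + X) ^ (i - 1)) +
        (j : ℝ[X]) * (X ^ i * (1 + X) ^ (j - 1) + X ^ (j - 1) * (1 + X) ^ i) := by
      simp only [derivative_add, derivative_mul, derivative_pow, derivative_X, derivative_one,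
        map_natCast]
      ring
    rw [this]
    refine add_mem ?_ ?_
    · rcases i with _ | i
      · simp
      · exact natCast_mul_mem _ (Submodule.subset_span ⟨_, _, by push_cast; ring, rfl⟩)
    · rcases j with _ | j
      · simp
      · exact natCast_mul_mem _ (Submodule.subset_span ⟨_, _, by push_cast; ring, rfl⟩)
  · refine mem_of_two_mul_mem (Submodule.subset_span ⟨1, 1, by norm_num, ?_⟩)
    ring
  · refine Submodule.subset_span ⟨0, 1, by norm_num, ?_⟩
    ring

theorem isDerivCone_gammaGen : IsDerivCone fun n => Submodule.span NNReal (gammaGen n) := by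
  refine isDerivCone_span ?_ ?_ ?_ ?_ ?_
  · exact Submodule.subset_span ⟨0, 0, by simp, by simp⟩
  · rintro m n _ _ ⟨i, j, rfl, rfl⟩ ⟨k, l, rfl, rfl⟩
    exact Submodule.subset_span ⟨i + k, j + l, by push_cast; ring, by ring⟩
  · rintro n _ ⟨i, j, rfl, rfl⟩
    have : derivative ((X * (1 + X)) ^ i * (1 + 2 * X) ^ j : ℝ[X]) =
        (i : ℝ[X]) * ((X * (1 + X)) ^ (i - 1) * (1 + 2 * X) ^ (j + 1)) +
        ((2 * j : ℕ) : ℝ[X]) * ((X * (1 + X)) ^ i * (1 + 2 * X) ^ (j - 1)) := by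
      have h2 : derivative (2 : ℝ[X]) = 0 := derivative_ofNat 2
      simp only [derivative_add, derivative_mul, derivative_pow, derivative_X, derivative_one,
        map_natCast, h2]
      push_cast
      ring
    rw [this]
    refine add_mem ?_ ?_
    · rcases i with _ | i
      · simp
      · exact natCast_mul_mem _ (Submodule.subset_span ⟨_, _, by push_cast; ring, rfl⟩)
    · rcases j with _ | j
      · simp
      · exact natCast_mul_mem _ (Submodule.subset_span ⟨_, _, by push_cast; ring, rfl⟩)
  · exact Submodule.subset_span ⟨1, 0, by norm_num, by simp⟩
  · exact Submodule.subset_span ⟨0, 1, by norm_num, by simp⟩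

/-- The bound is put on coefficients so that `n < 0` forces `f = 0`, which a bound on `natDegree`
truncated at zero would not. -/
theorem coeff_eq_zero_of_mem_span {S : Set ℝ[X]} {n : ℤ} (hS : ∀ f ∈ S, (f.natDegree : ℤ) ≤ n)
    {f : ℝ[X]} (hf : f ∈ Submodule.span NNReal S) {k : ℕ} (hk : n < k) : f.coeff k = 0 := by
  induction hf using Submodule.span_induction with
  | mem f hf => exact coeff_eq_zero_of_natDegree_lt (by have := hS f hf; omega)
  | zero => simp
  | add f g _ _ hf hg => rw [coeff_add, hf, hg, add_zero]
  | smul c f _ hf => rw [coeff_smul, hf, smul_zero]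

theorem coeff_eq_zero_of_mem_span_nonnegGen {n : ℤ} {f : ℝ[X]}
    (hf : f ∈ Submodule.span NNReal (nonnegGen n)) {k : ℕ} (hk : n < k) : f.coeff k = 0 := by
  refine coeff_eq_zero_of_mem_span ?_ hf hk
  rintro _ ⟨i, j, rfl, rfl⟩
  have : (X ^ i * (1 + X) ^ j + X ^ j * (1 + X) ^ i : ℝ[X]).natDegree ≤ i + j := by
    compute_degree
    omega
  exact_mod_cast this

theorem coeff_eq_zero_of_mem_span_gammaGen {n : ℤ} {f : ℝ[X]}
    (hf : f ∈ Submodule.span NNReal (gammaGen n)) {k : ℕ} (hk : n < k) : f.coeff k = 0 := by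
  refine coeff_eq_zero_of_mem_span ?_ hf hk
  rintro _ ⟨i, j, rfl, rfl⟩
  have h2 : (X * (1 + X) : ℝ[X]).natDegree ≤ 2 := by compute_degree
  have h1 : (1 + 2 * X : ℝ[X]).natDegree ≤ 1 := by compute_degree
  have := natDegree_mul_le_of_le (natDegree_pow_le_of_le i h2) (natDegree_pow_le_of_le j h1)
  zify at this
  linarith

theorem toNumer_X_mul {d : ℕ} {B : ℝ[X]} (h : ∀ k : ℕ, (d : ℤ) - 1 < k → B.coeff k = 0) :
    toNumer d (X * B) = X * toNumer ((d : ℤ) - 1).toNat B := by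
  rcases d with _ | d
  · have : B = 0 := by
      ext k
      exact h k (by push_cast; omega)
    simp [this]
  · have hB : B.natDegree ≤ d :=
      natDegree_le_iff_coeff_eq_zero.mpr fun k hk => h k (by push_cast; omega)
    rw [show ((d + 1 : ℕ) : ℤ) - 1 = d by push_cast; ring, Int.toNat_natCast, add_comm d 1,
      toNumer_mul natDegree_X_le hB, toNumer_one_X]

/-! ### Images of the cones among numerators -/

/-- The generators `x^i + x^j` with `i + j = n`. -/
def nonnegSymmGen (n : ℤ) : Set ℝ[X] :=
  {f | ∃ i j : ℕ, (i + j : ℤ) = n ∧ f = X ^ i + X ^ j}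

/-- The generators `x^i (1 + x)^j` with `2 i + j = n`. -/
def gammaPositiveGen (n : ℤ) : Set ℝ[X] :=
  {f | ∃ i j : ℕ, (2 * i + j : ℤ) = n ∧ f = X ^ i * (1 + X) ^ j}

/-- In degree one, `x ↦ x` and `1 + x ↦ 1`, and the map is multiplicative. -/
theorem toNumer_X_pow_mul_one_add_X_pow (i j : ℕ) :
    toNumer (i + j) (X ^ i * (1 + X) ^ j) = X ^ i := by
  have h1 : (1 + X : ℝ[X]).natDegree ≤ 1 := by compute_degree
  have e1 := toNumer_pow natDegree_X_le i
  have e2 := toNumer_pow h1 j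
  have := toNumer_mul (natDegree_pow_le_of_le i natDegree_X_le) (natDegree_pow_le_of_le j h1)
  rw [e1, e2, toNumer_one_X, toNumer_one_one_add_X, one_pow] at this
  simpa using this

theorem toNumer_X_mul_one_add_X_pow_mul (i j : ℕ) :
    toNumer (2 * i + j) ((X * (1 + X)) ^ i * (1 + 2 * X) ^ j) = X ^ i * (1 + X) ^ j := by
  have h2 : (X * (1 + X) : ℝ[X]).natDegree ≤ 2 := by compute_degree
  have h1 : (1 + 2 * X : ℝ[X]).natDegree ≤ 1 := by compute_degree
  have e1 := toNumer_pow h2 i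
  have e2 := toNumer_pow h1 j
  have e3 : toNumer 2 (X * (1 + X)) = X := by
    simpa using toNumer_X_pow_mul_one_add_X_pow 1 1
  have e4 : toNumer 1 (1 + 2 * X) = 1 + X := by
    rw [show (1 + 2 * X : ℝ[X]) = 1 + X + X by ring, map_add, toNumer_one_one_add_X, toNumer_one_X]
  have := toNumer_mul (natDegree_pow_le_of_le i h2) (natDegree_pow_le_of_le j h1)
  rw [e1, e2, e3, e4] at this
  simpa [mul_comm] using this

theorem toNumer_image_nonnegGen (n : ℤ) :
    toNumer n.toNat '' nonnegGen n = nonnegSymmGen n := by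
  have key : ∀ i j : ℕ, toNumer (i + j : ℤ).toNat (X ^ i * (1 + X) ^ j + X ^ j * (1 + X) ^ i) =
      X ^ i + X ^ j := by
    intro i j
    rw [show (i + j : ℤ).toNat = i + j by omega, map_add, toNumer_X_pow_mul_one_add_X_pow,
      add_comm i j, toNumer_X_pow_mul_one_add_X_pow]
  ext f
  constructor
  · rintro ⟨_, ⟨i, j, rfl, rfl⟩, rfl⟩
    exact ⟨i, j, rfl, key i j⟩
  · rintro ⟨i, j, rfl, rfl⟩
    exact ⟨_, ⟨i, j, rfl, rfl⟩, key i j⟩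

theorem toNumer_image_gammaGen (n : ℤ) :
    toNumer n.toNat '' gammaGen n = gammaPositiveGen n := by
  have key : ∀ i j : ℕ, toNumer (2 * i + j : ℤ).toNat ((X * (1 + X)) ^ i * (1 + 2 * X) ^ j) =
      X ^ i * (1 + X) ^ j := by
    intro i j
    rw [show (2 * i + j : ℤ).toNat = 2 * i + j by omega, toNumer_X_mul_one_add_X_pow_mul]
  ext f
  constructor
  · rintro ⟨_, ⟨i, j, rfl, rfl⟩, rfl⟩
    exact ⟨i, j, rfl, key i j⟩
  · rintro ⟨i, j, rfl, rfl⟩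
    exact ⟨_, ⟨i, j, rfl, rfl⟩, key i j⟩

/-! ### The common argument for both assertions -/

/-- `h = a + x b` with `a` and `b` in the cones spanned by `T d` and `T (d - 1)`. -/
def HasSpanDecomp (T : ℤ → Set ℝ[X]) (d : ℕ) (h : ℝ[X]) : Prop :=
  ∃ a ∈ Submodule.span NNReal (T d), ∃ b ∈ Submodule.span NNReal (T ((d : ℤ) - 1)), h = a + X * b

theorem HasSpanDecomp.numer_mul {S T : ℤ → Set ℝ[X]}
    (hS : IsDerivCone fun n => Submodule.span NNReal (S n))
    (hdeg : ∀ {n : ℤ} {f : ℝ[X]}, f ∈ Submodule.span NNReal (S n) → ∀ {k : ℕ}, n < k →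
      f.coeff k = 0)
    (hST : ∀ n : ℤ, toNumer n.toNat '' S n = T n) {p q : ℝ[X]}
    (hp : HasSpanDecomp T p.natDegree (numer p)) (hq : HasSpanDecomp T q.natDegree (numer q)) :
    HasSpanDecomp T (p * q).natDegree (numer (p * q)) := by
  have hmem : ∀ {n : ℤ} {a : ℝ[X]}, a ∈ Submodule.span NNReal (T n) ↔
      ∃ A ∈ Submodule.span NNReal (S n), toNumer n.toNat A = a := by
    -- A linear map sends the span of a set to the span of its image, here over the nonnegative
    -- reals.
    intro n a
    rw [← hST n]
    exact (SetLike.ext_iff.mp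
      (Submodule.map_span ((toNumer n.toNat).restrictScalars NNReal) (S n)) a).symm
  have hiff : ∀ {d : ℕ} {F : ℝ[X]}, HasSpanDecomp T d (toNumer d F) ↔
      ∃ A ∈ Submodule.span NNReal (S d), ∃ B ∈ Submodule.span NNReal (S ((d : ℤ) - 1)),
        F = A + X * B := by
    intro d F
    constructor
    · rintro ⟨a, ha, b, hb, h⟩
      obtain ⟨A, hA, rfl⟩ := hmem.mp ha
      obtain ⟨B, hB, rfl⟩ := hmem.mp hb
      refine ⟨A, hA, B, hB, toNumer_injective d ?_⟩
      rw [h, map_add, toNumer_X_mul fun k hk => hdeg hB hk, Int.toNat_natCast]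
    · rintro ⟨A, hA, B, hB, rfl⟩
      refine ⟨_, hmem.mpr ⟨A, hA, rfl⟩, _, hmem.mpr ⟨B, hB, rfl⟩, ?_⟩
      rw [map_add, toNumer_X_mul fun k hk => hdeg hB hk, Int.toNat_natCast]
  -- The zero product is separate: `natDegree` is additive only for nonzero factors.
  rcases eq_or_ne (p * q) 0 with h0 | h0
  · rw [h0, numer_eq_toNumer]
    exact ⟨0, zero_mem _, 0, zero_mem _, by simp [umbral]⟩
  rw [numer_eq_toNumer, hiff] at hp hq ⊢
  obtain ⟨A, hA, B, hB, hpe⟩ := hp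
  obtain ⟨A', hA', B', hB', hqe⟩ := hq
  -- This cutoff exceeds `deg q`, as `umbral_mul` requires, and its predecessor exceeds `deg B'`, as
  -- `diamond_mem` requires.
  rw [umbral_mul (M := q.natDegree + B'.natDegree + 1 + 1) p q (by omega), hpe, hqe,
    natDegree_mul (left_ne_zero_of_mul h0) (right_ne_zero_of_mul h0), Nat.cast_add]
  exact hS.diamond_mem hA hB hA' hB' (by omega)

/-! ### Spans versus symmetry, nonnegativity and `γ`-positivity -/

theorem IsSymmetric.add {n : ℤ} {a b : ℝ[X]} (ha : IsSymmetric n a) (hb : IsSymmetric n b) :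
    IsSymmetric n (a + b) := by
  unfold IsSymmetric inversion at *
  rw [map_add, map_add, mul_add, ha, hb]

theorem IsSymmetric.smul {n : ℤ} {a : ℝ[X]} (c : ℝ) (ha : IsSymmetric n a) :
    IsSymmetric n (c • a) := by
  unfold IsSymmetric inversion at *
  rw [smul_eq_C_mul, map_mul, map_mul, toLaurent_C, LaurentPolynomial.invert_C, mul_left_comm, ha]

theorem IsSymmetric.mul {m n : ℤ} {a b : ℝ[X]} (ha : IsSymmetric m a) (hb : IsSymmetric n b) :
    IsSymmetric (m + n) (a * b) := by
  unfold IsSymmetric inversion at *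
  rw [map_mul, map_mul, LaurentPolynomial.T_add, mul_mul_mul_comm, ha, hb]

theorem isSymmetric_zero (n : ℤ) : IsSymmetric n 0 := by
  simp [IsSymmetric, inversion]

theorem isSymmetric_one : IsSymmetric 0 1 := by
  simp [IsSymmetric, inversion]

theorem IsSymmetric.pow {n : ℤ} {a : ℝ[X]} (ha : IsSymmetric n a) (k : ℕ) :
    IsSymmetric (n * k) (a ^ k) := by
  induction k with
  | zero => simpa using isSymmetric_one
  | succ k ih =>
    rw [pow_succ]
    convert ih.mul ha using 1
    push_cast; ring

theorem isSymmetric_X : IsSymmetric 2 X := by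
  simp only [IsSymmetric, inversion, toLaurent_X, LaurentPolynomial.invert_T]
  rw [← LaurentPolynomial.T_add]; norm_num

theorem isSymmetric_one_add_X : IsSymmetric 1 (1 + X) := by
  simp only [IsSymmetric, inversion, toLaurent_X, LaurentPolynomial.invert_T, map_add, map_one,
    mul_add, mul_one]
  rw [← LaurentPolynomial.T_add, add_neg_cancel, LaurentPolynomial.T_zero, add_comm]

theorem isSymmetric_X_pow_add_X_pow (i j : ℕ) : IsSymmetric (i + j) (X ^ i + X ^ j) := by
  simp only [IsSymmetric, inversion, toLaurent_X_pow, LaurentPolynomial.invert_T, map_add, mul_add]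
  rw [← LaurentPolynomial.T_add, ← LaurentPolynomial.T_add, add_comm]
  congr 2 <;> ring

theorem isSymmetric_of_mem_span {n : ℤ} {S : Set ℝ[X]} (hS : ∀ f ∈ S, IsSymmetric n f) {f : ℝ[X]}
    (hf : f ∈ Submodule.span NNReal S) : IsSymmetric n f := by
  induction hf using Submodule.span_induction with
  | mem f hf => exact hS f hf
  | zero => exact isSymmetric_zero n
  | add f g _ _ hf hg => exact hf.add hg
  | smul c f _ hf => exact hf.smul (c : ℝ)

theorem IsSymmetric.toLaurent_coeff {n : ℤ} {a : ℝ[X]} (ha : IsSymmetric n a) (m : ℤ) :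
    (toLaurent a).coeff m = (toLaurent a).coeff (n - m) := by
  have key : ∀ f : ℝ[T;T⁻¹], (LaurentPolynomial.T n * f).coeff m = f.coeff (m - n) := by
    intro f
    rw [LaurentPolynomial.T, AddMonoidAlgebra.coeff_single_mul_eq_mul_coeff (m - n), one_mul]
    intro x _
    constructor <;> intro h <;> linarith
  conv_lhs => rw [← show _ = toLaurent a from ha, inversion, key, LaurentPolynomial.invert_apply]
  rw [neg_sub]

theorem coeff_toLaurent_natCast (a : ℝ[X]) (k : ℕ) : (toLaurent a).coeff (k : ℤ) = a.coeff k := by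
  rw [LaurentPolynomial.coeff_toLaurent]
  exact Finsupp.mapDomain_apply Nat.cast_injective _ k

theorem coeff_toLaurent_of_neg (a : ℝ[X]) {m : ℤ} (hm : m < 0) : (toLaurent a).coeff m = 0 := by
  rw [LaurentPolynomial.coeff_toLaurent]
  refine Finsupp.mapDomain_of_notMem_range _ _ ?_
  rintro ⟨k, rfl⟩
  simp only [Nat.castEmbedding_apply] at hm
  omega

/-- The symmetry exchanges the exponents `k` and `n - k < 0`, and a polynomial has no negative
exponents. -/
theorem IsSymmetric.coeff_eq_zero {n : ℤ} {a : ℝ[X]} (ha : IsSymmetric n a) {k : ℕ}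
    (hk : n < k) : a.coeff k = 0 := by
  rw [← coeff_toLaurent_natCast, ha.toLaurent_coeff, coeff_toLaurent_of_neg a (by omega)]

theorem IsSymmetric.coeff_eq {n k l : ℕ} {a : ℝ[X]} (ha : IsSymmetric n a)
    (h : k + l = n) : a.coeff k = a.coeff l := by
  rw [← coeff_toLaurent_natCast, ha.toLaurent_coeff, show (n : ℤ) - k = l by omega,
    coeff_toLaurent_natCast]

theorem mem_span_nonnegSymmGen {n : ℤ} {a : ℝ[X]} :
    a ∈ Submodule.span NNReal (nonnegSymmGen n) ↔ IsSymmetric n a ∧ NonnegCoeffs a := by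
  constructor
  · intro h
    refine ⟨isSymmetric_of_mem_span ?_ h, ?_⟩
    · rintro _ ⟨i, j, rfl, rfl⟩
      exact isSymmetric_X_pow_add_X_pow i j
    · induction h using Submodule.span_induction with
      | mem f hf =>
        obtain ⟨i, j, rfl, rfl⟩ := hf
        intro k
        simp only [coeff_add, coeff_X_pow]
        positivity
      | zero => intro k; simp
      | add f g _ _ hf hg => intro k; rw [coeff_add]; exact add_nonneg (hf k) (hg k)
      | smul c f _ hf => intro k; rw [coeff_smul]; exact smul_nonneg c.2 (hf k)
  · rintro ⟨hs, hn⟩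
    rcases lt_or_ge n 0 with h | h
    · have : a = 0 := by
        ext k
        exact hs.coeff_eq_zero (by omega)
      rw [this]; exact zero_mem _
    lift n to ℕ using h
    refine mem_of_two_mul_mem ?_
    have e : a = ∑ k ∈ Finset.range (n + 1), C (a.coeff k) * X ^ k :=
      a.as_sum_range_C_mul_X_pow' (Nat.lt_succ_of_le
        (natDegree_le_iff_coeff_eq_zero.mpr fun k hk => hs.coeff_eq_zero (by exact_mod_cast hk)))
    -- Adding `a` to its reflected expansion pairs `x^k` with `x^(n-k)`; doubling also treats the
    -- middle term uniformly.
    have e2 : 2 * a = ∑ k ∈ Finset.range (n + 1), a.coeff k • (X ^ k + X ^ (n - k)) := by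
      have e' : a = ∑ k ∈ Finset.range (n + 1), C (a.coeff k) * X ^ (n - k) := by
        refine e.trans ((Finset.sum_range_reflect _ _).symm.trans
          (Finset.sum_congr rfl fun k hk => ?_))
        have hk := Finset.mem_range.mp hk
        rw [show n + 1 - 1 - k = n - k by omega, hs.coeff_eq (k := n - k) (l := k) (by omega)]
      rw [two_mul]
      refine (congrArg₂ (· + ·) e e').trans ?_
      rw [← Finset.sum_add_distrib]
      exact Finset.sum_congr rfl fun k _ => by rw [smul_eq_C_mul, mul_add]
    rw [e2]
    refine sum_mem fun k hk => ?_
    have hk := Finset.mem_range.mp hk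
    exact Submodule.smul_mem _ (⟨a.coeff k, hn k⟩ : NNReal)
      (Submodule.subset_span ⟨k, n - k, by omega, rfl⟩)

theorem mem_span_gammaPositiveGen {n : ℤ} {a : ℝ[X]} :
    a ∈ Submodule.span NNReal (gammaPositiveGen n) ↔ IsGammaPositive n a := by
  constructor
  · intro h
    induction h using Submodule.span_induction with
    | mem f hf =>
      obtain ⟨i, j, rfl, rfl⟩ := hf
      refine ⟨Pi.single i 1, fun k => ?_, ?_⟩
      · by_cases h : k = i
        · subst h; simp
        · simp [h]
      · rw [Finset.sum_eq_single_of_mem i (by rw [Finset.mem_range]; omega)]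
        · rw [show (2 * i + j - 2 * i : ℤ).toNat = j by omega]
          simp
        · intro k _ hk
          simp [hk]
    | zero => exact ⟨0, fun _ => le_rfl, by simp⟩
    | add f g _ _ hf hg =>
      obtain ⟨γ, hγ, rfl⟩ := hf
      obtain ⟨δ, hδ, rfl⟩ := hg
      refine ⟨γ + δ, fun i => add_nonneg (hγ i) (hδ i), ?_⟩
      rw [← Finset.sum_add_distrib]
      refine Finset.sum_congr rfl fun i _ => ?_
      rw [Pi.add_apply, C_add, add_mul]
    | smul c f _ hf =>
      obtain ⟨γ, hγ, rfl⟩ := hf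
      refine ⟨fun i => c * γ i, fun i => mul_nonneg c.2 (hγ i), ?_⟩
      rw [NNReal.smul_def, smul_eq_C_mul, Finset.mul_sum]
      refine Finset.sum_congr rfl fun i _ => ?_
      rw [C_mul, mul_assoc]
  · rintro ⟨γ, hγ, rfl⟩
    refine sum_mem fun i hi => ?_
    have hi := Finset.mem_range.mp hi
    rw [← smul_eq_C_mul]
    exact Submodule.smul_mem _ (⟨γ i, hγ i⟩ : NNReal)
      (Submodule.subset_span ⟨i, _, by omega, rfl⟩)

theorem isSymmetric_of_isGammaPositive {n : ℤ} {a : ℝ[X]} (h : IsGammaPositive n a) :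
    IsSymmetric n a := by
  refine isSymmetric_of_mem_span ?_ (mem_span_gammaPositiveGen.mpr h)
  rintro _ ⟨i, j, rfl, rfl⟩
  simpa using (isSymmetric_X.pow i).mul (isSymmetric_one_add_X.pow j)

theorem hasSpanDecomp_nonnegSymmGen {d : ℕ} {h : ℝ[X]} :
    HasSpanDecomp nonnegSymmGen d h ↔ HasNonnegSymmDecomp d h := by
  constructor
  · rintro ⟨a, ha, b, hb, e⟩
    rw [mem_span_nonnegSymmGen] at ha hb
    exact ⟨a, b, ⟨e, ha.1, hb.1⟩, ha.2, hb.2⟩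
  · rintro ⟨a, b, hs, ha, hb⟩
    exact ⟨a, mem_span_nonnegSymmGen.mpr ⟨hs.symm_left, ha⟩, b,
      mem_span_nonnegSymmGen.mpr ⟨hs.symm_right, hb⟩, hs.eq_add⟩

theorem hasSpanDecomp_gammaPositiveGen {d : ℕ} {h : ℝ[X]} :
    HasSpanDecomp gammaPositiveGen d h ↔ HasGammaPositiveSymmDecomp d h := by
  constructor
  · rintro ⟨a, ha, b, hb, e⟩
    rw [mem_span_gammaPositiveGen] at ha hb
    exact ⟨a, b, ⟨e, isSymmetric_of_isGammaPositive ha, isSymmetric_of_isGammaPositive hb⟩, ha, hb⟩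
  · rintro ⟨a, b, hs, ha, hb⟩
    exact ⟨a, mem_span_gammaPositiveGen.mpr ha, b, mem_span_gammaPositiveGen.mpr hb, hs.eq_add⟩

end

theorem theorem1p4 (p q : ℝ[X]) :
    (HasNonnegSymmDecomp p.natDegree (numer p) →
      HasNonnegSymmDecomp q.natDegree (numer q) →
        HasNonnegSymmDecomp (p * q).natDegree (numer (p * q))) ∧
    (HasGammaPositiveSymmDecomp p.natDegree (numer p) →
      HasGammaPositiveSymmDecomp q.natDegree (numer q) →
        HasGammaPositiveSymmDecomp (p * q).natDegree (numer (p * q))) := by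
  simp only [← hasSpanDecomp_nonnegSymmGen, ← hasSpanDecomp_gammaPositiveGen]
  exact ⟨HasSpanDecomp.numer_mul isDerivCone_nonnegGen coeff_eq_zero_of_mem_span_nonnegGen
      toNumer_image_nonnegGen,
    HasSpanDecomp.numer_mul isDerivCone_gammaGen coeff_eq_zero_of_mem_span_gammaGen
      toNumer_image_gammaGen⟩
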